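/- Let $p$ be a prime number and let $\alpha=a/b\in\mathbb{Q}\cap(0,1]$ be a rational number, with $b\ge 1$ such that $p\equiv 1\bmod b$. Let $q$ be an indeterminate, let $\mathfrak m=(p,1-q)\subset\mathbb{Z}[q]$, and let $\mathbb{Z}_{q,p}$ be the completion of the local ring $\mathbb{Z}[q]_{\mathfrak m}$ for the $\mathfrak m$-adic topology. Let $\mathbf F_q:\mathbb{Z}_{q,p}\to\mathbb{Z}_{q,p}$ be the continuous ring endomorphism extending $P(q)/Q(q)\mapsto P(q^p)/Q(q^p)$ on $\mathbb{Z}[q]_{\mathfrak m}$, extended to power series by $\mathbf F_q\big(\sum_{n\ge 0}a_nz^n\big)=\sum_{n\ge 0}\mathbf F_q(a_n)z^{np}$. As $p\nmid b$, we have $\alpha\in\mathbb{Z}_p$, and $q^{\alpha}\in\mathbb{Z}_{q,p}$ denotes the limit of $q^{\alpha_n}$, where $\alpha_n\in\{0,\dots,p^n-1\}$ and $\alpha_n\equiv\alpha\bmod p^n\mathbb{Z}_p$. Put $(x;q)_n=\prod_{i=0}^{n-1}(1-xq^i)$ and $$f_\alpha=\sum_{n\ge 0}\frac{(q^\alpha;q)_n}{(q;q)_n}z^n,$$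 a power series over the ring of fractions of $\mathbb{Z}_{q,p}$. Then $f_\alpha\in\mathbb{Z}_{q,p}[[z]]$ and $$f_\alpha\equiv\Big(\sum_{n=0}^{p-1}\frac{(q^\alpha;q)_n}{(q;q)_n}z^n\Big)\,\mathbf F_q(f_\alpha)\bmod \phi_p(q)\,\mathbb{Z}_{q,p}[[z]],$$ where $\phi_p(q)=1+q+\cdots+q^{p-1}$ is the $p$-th cyclotomic polynomial. -/

import Mathlib

open Polynomial

namespace QFrobenius

noncomputable section

/-- The homomorphism `ℤ[q] → 𝔽_p`, `P(q) ↦ P(1) mod p`. -/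
def evModP (p : ℕ) : ℤ[X] →+* ZMod p :=
  Polynomial.eval₂RingHom (Int.castRingHom (ZMod p)) 1

/-- The ideal `𝔪 = (p, 1 - q)` of `ℤ[q]`; the indeterminate `q` is `X`. -/
def mIdeal (p : ℕ) : Ideal ℤ[X] := Ideal.span {C (p : ℤ), 1 - X}

theorem mIdeal_eq_ker (p : ℕ) : mIdeal p = RingHom.ker (evModP p) := by
  apply le_antisymm
  · rw [mIdeal, Ideal.span_le]
    rintro x (rfl | rfl) <;> simp [evModP, RingHom.mem_ker]
  · intro P hP
    rw [RingHom.mem_ker] at hP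
    have h1 : ((P.eval 1 : ℤ) : ZMod p) = 0 := by
      rw [← hP]
      simp [evModP, Polynomial.eval₂_eq_sum_range, Polynomial.eval_eq_sum_range]
    rw [ZMod.intCast_zmod_eq_zero_iff_dvd] at h1
    obtain ⟨k, hk⟩ := h1
    obtain ⟨Q, hQ⟩ := Polynomial.X_sub_C_dvd_sub_C_eval (p := P) (a := (1 : ℤ))
    have : P = C k * C (p : ℤ) + (-Q) * (1 - X) := by
      rw [hk] at hQ
      simp only [C_mul, C_1] at hQ
      linear_combination hQ
    rw [this]
    exact add_mem (Ideal.mul_mem_left _ _ (Ideal.subset_span (by simp)))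
      (Ideal.mul_mem_left _ _ (Ideal.subset_span (by simp)))

variable (p : ℕ) [hp : Fact p.Prime]

instance mIdeal_isPrime : (mIdeal p).IsPrime := by
  rw [mIdeal_eq_ker]
  exact RingHom.ker_isPrime _

/-- The local ring `ℤ[q]_𝔪`. -/
abbrev ZqLoc : Type := Localization.AtPrime (mIdeal p)

/-- The maximal ideal `𝔪 ℤ[q]_𝔪`. -/
abbrev mLoc : Ideal (ZqLoc p) := IsLocalRing.maximalIdeal (ZqLoc p)

/-- The ring `ℤ_{q,p}`: the completion of `ℤ[q]_𝔪` for the `𝔪`-adic norm (`|x| ≤ p⁻ⁿ` iff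
`x ∈ 𝔪ⁿ`), that is, its `𝔪`-adic completion. -/
abbrev Zqp : Type := AdicCompletion (mLoc p) (ZqLoc p)

/-- The element `q` of `ℤ[q]_𝔪`. -/
def qLoc : ZqLoc p := algebraMap ℤ[X] (ZqLoc p) X

/-- The canonical map `ℤ[q] → ℤ_{q,p}`. -/
def ofPoly : ℤ[X] →+* Zqp p :=
  (algebraMap (ZqLoc p) (Zqp p)).comp (algebraMap ℤ[X] (ZqLoc p))

/-- The element `q` of `ℤ_{q,p}`. -/
def q : Zqp p := ofPoly p X

/-- The `p`-th cyclotomic polynomial `φ_p(q) = 1 + q + ⋯ + q^{p-1}` as an element of `ℤ_{q,p}`. -/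
def phi : Zqp p := ofPoly p (Polynomial.cyclotomic p ℤ)

/-! ### The Frobenius endomorphism -/

theorem evModP_expand (P : ℤ[X]) : evModP p (Polynomial.expand ℤ p P) = evModP p P := by
  simp [evModP, Polynomial.expand_eq_comp_X_pow, Polynomial.eval₂_comp]

theorem mIdeal_comap_expand :
    mIdeal p = (mIdeal p).comap (Polynomial.expand ℤ p : ℤ[X] →+* ℤ[X]) := by
  ext P
  rw [Ideal.mem_comap, mIdeal_eq_ker, RingHom.mem_ker, RingHom.mem_ker]
  simp [evModP_expand]

/-- The endomorphism `P(q)/Q(q) ↦ P(q^p)/Q(q^p)` of `ℤ[q]_𝔪`. -/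
def frobLoc : ZqLoc p →+* ZqLoc p :=
  Localization.localRingHom (mIdeal p) (mIdeal p) (Polynomial.expand ℤ p : ℤ[X] →+* ℤ[X])
    (mIdeal_comap_expand p)

theorem mLoc_le_comap_frobLoc : mLoc p ≤ (mLoc p).comap (frobLoc p) := by
  have : IsLocalHom (frobLoc p) := Localization.isLocalHom_localRingHom _ _ _ _
  intro x hx
  exact map_nonunit (frobLoc p) x hx

theorem mLoc_pow_le_comap_frobLoc (n : ℕ) : mLoc p ^ n ≤ (mLoc p ^ n).comap (frobLoc p) :=
  (Ideal.pow_right_mono (mLoc_le_comap_frobLoc p) n).trans (Ideal.le_comap_pow _ n)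

/-- The map `ℤ_{q,p} → ℤ[q]_𝔪 / 𝔪ⁿ`, reduction modulo `𝔪ⁿ` followed by the map induced by
`frobLoc`. -/
def frobMod (n : ℕ) : Zqp p →+* ZqLoc p ⧸ mLoc p ^ n :=
  (Ideal.quotientMap (mLoc p ^ n) (frobLoc p) (mLoc_pow_le_comap_frobLoc p n)).comp
    (AdicCompletion.evalₐ (mLoc p) n : Zqp p →+* ZqLoc p ⧸ mLoc p ^ n)

theorem frobMod_compat {m n : ℕ} (hle : m ≤ n) :
    (Ideal.Quotient.factorPow (mLoc p) hle).comp (frobMod p n) = frobMod p m := by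
  ext x
  induction x using AdicCompletion.induction_on with
  | _ x =>
    simp only [frobMod, RingHom.comp_apply, RingHom.coe_coe, AdicCompletion.evalₐ_mk,
      Ideal.quotientMap_mk]
    exact congrArg (Ideal.quotientMap (mLoc p ^ m) (frobLoc p)
      (mLoc_pow_le_comap_frobLoc p m)) (AdicCompletion.Ideal.mk_eq_mk (mLoc p) hle x)

/-- The Frobenius endomorphism `𝐅_q` of `ℤ_{q,p}`: the continuous extension of
`P(q)/Q(q) ↦ P(q^p)/Q(q^p)`, which modulo each `𝔪ⁿ` is the map induced by `frobLoc`. -/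
def frob : Zqp p →+* Zqp p :=
  AdicCompletion.liftRingHom (mLoc p) (frobMod p) (frobMod_compat p)

/-- The extension of `𝐅_q` to `ℤ_{q,p}[[z]]`: `∑ aₙ zⁿ ↦ ∑ 𝐅_q(aₙ) z^{np}`. -/
def frobSeries : PowerSeries (Zqp p) →+* PowerSeries (Zqp p) :=
  (PowerSeries.expand (R := Zqp p) p hp.out.ne_zero).toRingHom.comp
    (PowerSeries.map (frob p))

/-! ### The power `q^β` for a `p`-adic integer `β` -/

theorem ofNat_mem_mLoc : ((p : ℕ) : ZqLoc p) ∈ mLoc p := by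
  have h : (C (p : ℤ) : ℤ[X]) ∈ mIdeal p := Ideal.subset_span (by simp)
  have := (IsLocalization.AtPrime.to_map_mem_maximal_iff (ZqLoc p) (mIdeal p) _).mpr h
  simpa using this

theorem qLoc_sub_one_mem : qLoc p - 1 ∈ mLoc p := by
  have h : (X - 1 : ℤ[X]) ∈ mIdeal p := by
    rw [← neg_sub]
    exact neg_mem (Ideal.subset_span (by simp))
  have := (IsLocalization.AtPrime.to_map_mem_maximal_iff (ZqLoc p) (mIdeal p) _).mpr h
  simpa [qLoc] using this

theorem qLoc_pow_sub_one_mem (n : ℕ) : qLoc p ^ p ^ n - 1 ∈ mLoc p ^ n := by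
  have hq : ∀ n : ℕ, qLoc p ^ n - 1 ∈ mLoc p := fun n =>
    Ideal.mem_of_dvd _ (by simpa using sub_dvd_pow_sub_pow (qLoc p) 1 n) (qLoc_sub_one_mem p)
  induction n with
  | zero => simp
  | succ n ih =>
    rw [pow_succ p n, pow_mul, ← mul_geom_sum, pow_succ]
    refine Ideal.mul_mem_mul ih ?_
    have h : ∑ i ∈ Finset.range p, (qLoc p ^ p ^ n) ^ i =
        ∑ i ∈ Finset.range p, ((qLoc p ^ p ^ n) ^ i - 1) + (p : ZqLoc p) := by simp
    rw [h]
    refine add_mem (sum_mem fun i _ => ?_) (ofNat_mem_mLoc p)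
    rw [← pow_mul]
    exact hq _

/-- `q^β = lim q^{βₙ}` for a `p`-adic integer `β`, where `βₙ` is the natural number below `p^n`
with `β ≡ βₙ mod p^n` (the truncation of the `p`-adic expansion of `β`). -/
def qPow (β : ℤ_[p]) : Zqp p :=
  AdicCompletion.mk (mLoc p) (ZqLoc p)
    (AdicCompletion.AdicCauchySequence.mk (mLoc p) (ZqLoc p) (fun n => qLoc p ^ β.appr n)
      (by
        intro n
        obtain ⟨k, hk⟩ := PadicInt.dvd_appr_sub_appr β n (n + 1) (Nat.le_succ n)
        have hle : β.appr n ≤ β.appr (n + 1) := PadicInt.appr_mono β (Nat.le_succ n)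
        have he : β.appr (n + 1) = β.appr n + p ^ n * k := by omega
        have h1 : qLoc p ^ (p ^ n * k) - 1 ∈ mLoc p ^ n := by
          rw [pow_mul]
          exact Ideal.mem_of_dvd _ (by simpa using sub_dvd_pow_sub_pow (qLoc p ^ p ^ n) 1 k)
            (qLoc_pow_sub_one_mem p n)
        rw [SModEq.comm, SModEq.sub_mem, smul_eq_mul, Ideal.mul_top, he, pow_add]
        have := Ideal.mul_mem_left _ (qLoc p ^ β.appr n) h1
        rwa [mul_sub, mul_one] at this))

/-! ### The series `f_α` -/

/-- The `q`-Pochhammer symbol `(x;q)_n = (1 - x)(1 - xq)⋯(1 - xq^{n-1})` in `ℤ_{q,p}`. -/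
def qPoch (x : Zqp p) (n : ℕ) : Zqp p := ∏ i ∈ Finset.range n, (1 - x * q p ^ i)

theorem algebraMap_mem_nonZeroDivisors_adicCompletion {R : Type} [CommRing R] [IsDomain R]
    [IsNoetherianRing R] (I : Ideal R) {r : R} (hr : r ≠ 0) :
    algebraMap R (AdicCompletion I R) r ∈ nonZeroDivisors (AdicCompletion I R) := by
  have h1 := Module.Flat.isSMulRegular_of_nonZeroDivisors (M := AdicCompletion I R)
    (mem_nonZeroDivisors_of_ne_zero hr)
  have h2 : ∀ y : AdicCompletion I R, r • y = algebraMap R (AdicCompletion I R) r * y :=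
    fun y => Subtype.ext (Algebra.smul_def r y.val)
  rw [mem_nonZeroDivisors_iff_right]
  intro x hx
  refine h1 ((h2 x).trans (Eq.trans ?_ (h2 0).symm))
  rw [mul_comm, hx, mul_zero]

theorem ofPoly_mem_nonZeroDivisors {P : ℤ[X]} (hP : P ≠ 0) :
    ofPoly p P ∈ nonZeroDivisors (Zqp p) := by
  have : IsNoetherianRing (ZqLoc p) :=
    IsLocalization.isNoetherianRing (mIdeal p).primeCompl _ inferInstance
  have : IsDomain (ZqLoc p) :=
    IsLocalization.isDomain_localization (mIdeal p).primeCompl_le_nonZeroDivisors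
  refine algebraMap_mem_nonZeroDivisors_adicCompletion (mLoc p) ?_
  rw [Ne, IsLocalization.to_map_eq_zero_iff (ZqLoc p)
    (mIdeal p).primeCompl_le_nonZeroDivisors]
  exact hP

/-- `(q;q)_n` is not a zero divisor of `ℤ_{q,p}`. -/
theorem qPoch_q_mem_nonZeroDivisors (n : ℕ) : qPoch p (q p) n ∈ nonZeroDivisors (Zqp p) := by
  refine Submonoid.prod_mem _ fun i _ => ?_
  have : 1 - q p * q p ^ i = ofPoly p (1 - X ^ (i + 1)) := by
    simp [q, pow_succ']
  rw [this]
  refine ofPoly_mem_nonZeroDivisors p fun h => ?_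
  have := congrArg (Polynomial.eval 0) h
  simp at this

/-- The fraction `(q^β;q)_n / (q;q)_n` in the ring of fractions of `ℤ_{q,p}`. -/
def hypCoeff (β : ℤ_[p]) (n : ℕ) : FractionRing (Zqp p) :=
  IsLocalization.mk' (FractionRing (Zqp p)) (qPoch p (qPow p β) n)
    (⟨qPoch p (q p) n, qPoch_q_mem_nonZeroDivisors p n⟩ : nonZeroDivisors (Zqp p))

/-- The series `f_β = ∑ (q^β;q)_n / (q;q)_n zⁿ` over the ring of fractions of `ℤ_{q,p}`. -/
def hypSeries (β : ℤ_[p]) : PowerSeries (FractionRing (Zqp p)) :=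
  PowerSeries.mk (hypCoeff p β)

theorem not_dvd_of_modEq_one {b : ℕ} (h : p ≡ 1 [MOD b]) : ¬ p ∣ b := by
  intro hd
  have h1 : p ≡ 1 [MOD p] := h.of_dvd hd
  have h2 : p ∣ 1 := (Nat.modEq_zero_iff_dvd).mp (h1.symm.trans (by simp [Nat.ModEq]))
  exact hp.out.one_lt.ne' (Nat.dvd_one.mp h2)

/-- A rational number whose denominator is prime to `p`, as a `p`-adic integer. -/
def ratToPadicInt (α : ℚ) (h : ¬ p ∣ α.den) : ℤ_[p] :=
  ⟨(α : ℚ_[p]), Padic.norm_rat_le_one h⟩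

end

end QFrobenius

/-! For N ∈ ℕ, (q^N;q)_n / (q;q)_n is the polynomial `gaussCoeff N n`, the coefficient of z^n in
1/∏_{i<N} (1 - q^i z). At a primitive p-th root of unity, p consecutive factors multiply to 1 - z^p.
So if N + s = pM with s < p, the series becomes T(z)(1 - z^p)^(-M) with deg T < p, and comparing
coefficients gives the congruence modulo φ_p for exponent N (`cyclotomic_dvd_gaussCoeff_sub`).

As p ≡ 1 mod b and 0 < α ≤ 1, s = (p-1)α is an integer in [0, p), and pα = α + s. Hence 𝐅_q(q^α) =
q^α q^s, and α is a p-adic limit of integers N as above. Integrality and the congruence pass to the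
limit because principal ideals generated by nonzero polynomials are closed in ℤ_{q,p}
(`ofPoly_dvd_of_forall_evalₐ`). -/

namespace QFrobenius

/-! ### Closedness of principal ideals -/

/-- Principal ideals of a noetherian domain stay closed in its adic completions: an element of the
completion that is congruent to a multiple of `r` modulo each power of `I` is a multiple of `r`. -/
theorem algebraMap_dvd_of_forall_evalₐ {R : Type} [CommRing R] [IsDomain R] [IsNoetherianRing R]
    (I : Ideal R) {r : R} (hr : r ≠ 0) {x : AdicCompletion I R}
    (h : ∀ n, ∃ y, r ∣ y ∧ AdicCompletion.evalₐ I n x = Ideal.Quotient.mk (I ^ n) y) :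
    algebraMap R (AdicCompletion I R) r ∣ x := by
  have hinj : Function.Injective (LinearMap.toSpanSingleton R R r) := fun a b hab => by
    simpa [hr] using hab
  have hex : Function.Exact (LinearMap.toSpanSingleton R R r)
      (Submodule.mkQ (Ideal.span {r})) := by
    rw [LinearMap.exact_iff, Submodule.ker_mkQ, LinearMap.range_toSpanSingleton]
  -- Completion is exact on finite modules over a noetherian ring, so it suffices that x dies in the
  -- completion of R/(r).
  have hex' := AdicCompletion.map_exact (I := I) hinj hex (Submodule.mkQ_surjective _)
  obtain ⟨y, rfl⟩ := (hex' x).1 (by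
    induction x using AdicCompletion.induction_on with
    | _ a =>
    rw [AdicCompletion.map_mk]
    apply AdicCompletion.ext
    intro n
    obtain ⟨y, ⟨c, rfl⟩, hy⟩ := h n
    rw [AdicCompletion.evalₐ_mk, Ideal.Quotient.eq] at hy
    rw [AdicCompletion.mk_apply_coe]
    change Submodule.mkQ _ (Submodule.mkQ _ (a.val n)) = 0
    rw [Submodule.mkQ_apply, Submodule.Quotient.mk_eq_zero]
    have : Submodule.mkQ (Ideal.span {r}) (a.val n) =
        Submodule.mkQ (Ideal.span {r}) (a.val n - r * c) := by
      have hc : Submodule.mkQ (Ideal.span {r}) (r * c) = 0 := by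
        rw [Submodule.mkQ_apply, Submodule.Quotient.mk_eq_zero, Ideal.mem_span_singleton]
        exact dvd_mul_right r c
      rw [map_sub, hc, sub_zero]
    rw [this]
    have h2 := Submodule.mem_map_of_mem (f := Submodule.mkQ (Ideal.span {r})) hy
    have h3 := Submodule.map_smul'' (I ^ n) ⊤ (Submodule.mkQ (Ideal.span {r}))
    rw [smul_eq_mul, Ideal.mul_top] at h3
    rw [h3] at h2
    exact Submodule.smul_mono le_rfl le_top h2)
  refine ⟨y, ?_⟩
  induction y using AdicCompletion.induction_on with
  | _ a =>
  apply AdicCompletion.ext_evalₐ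
  intro n
  rw [AdicCompletion.map_mk, map_mul, AlgHom.commutes, AdicCompletion.evalₐ_mk,
    AdicCompletion.evalₐ_mk, mul_comm]
  rfl

/-! ### Gaussian binomials and their generating series -/

/-- The coefficient of `zⁿ` in `1 / ∏_{i < N} (1 - z qⁱ)`, which is the Gaussian binomial
coefficient `[N + n - 1, n]`, as a polynomial in `q`. -/
noncomputable def gaussCoeff : ℕ → ℕ → ℤ[X]
  | _, 0 => 1
  | 0, _ + 1 => 0
  | N + 1, n + 1 => gaussCoeff N (n + 1) + X ^ N * gaussCoeff (N + 1) n

@[simp]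
theorem gaussCoeff_zero_right (N : ℕ) : gaussCoeff N 0 = 1 := by
  cases N <;> simp [gaussCoeff]

/-- The `q`-Pochhammer symbol `(x;a)_n` over an arbitrary ring. -/
def poch {R : Type*} [CommRing R] (a x : R) (n : ℕ) : R := ∏ i ∈ Finset.range n, (1 - x * a ^ i)

theorem map_poch {R S : Type*} [CommRing R] [CommRing S] (f : R →+* S) (a x : R) (n : ℕ) :
    f (poch a x n) = poch (f a) (f x) n := by
  simp [poch, map_prod]

theorem poch_succ {R : Type*} [CommRing R] (a x : R) (n : ℕ) :
    poch a x (n + 1) = poch a x n * (1 - x * a ^ n) :=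
  Finset.prod_range_succ _ _

theorem poch_succ' {R : Type*} [CommRing R] (a x : R) (n : ℕ) :
    poch a x (n + 1) = (1 - x) * poch a (x * a) n := by
  simp [poch, Finset.prod_range_succ', mul_comm (1 - x), mul_assoc, pow_succ']

theorem poch_mul_gaussCoeff (N n : ℕ) :
    poch X X n * gaussCoeff N n = poch (X : ℤ[X]) (X ^ N) n := by
  induction N, n using gaussCoeff.induct with
  | case1 N => simp [poch]
  | case2 n => simp [poch_succ', gaussCoeff]
  | case3 N n ih1 ih2 =>
    rw [gaussCoeff, mul_add, ih1, poch_succ X X, poch_succ' X (X ^ N), ← pow_succ,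
      poch_succ X (X ^ (N + 1))]
    linear_combination (X : ℤ[X]) ^ N * (1 - X * X ^ n) * ih2

/-- The recursion for `gaussCoeff` says that multiplying the series for N + 1 by 1 - q^N z gives the
series for N. -/
theorem mk_gaussCoeff_mul_prod {R : Type*} [CommRing R] (f : ℤ[X] →+* R) (N : ℕ) :
    (PowerSeries.mk fun n => f (gaussCoeff N n)) *
      ∏ i ∈ Finset.range N, (1 - PowerSeries.C (f X ^ i) * PowerSeries.X) = 1 := by
  induction N with
  | zero =>
    ext n
    cases n <;> simp [gaussCoeff, PowerSeries.coeff_one]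
  | succ N ih =>
    conv_rhs => rw [← ih]
    rw [Finset.prod_range_succ, mul_comm (∏ _ ∈ _, _), ← mul_assoc]
    congr 1
    rw [mul_sub, mul_one, mul_left_comm]
    ext n
    cases n with
    | zero => simp
    | succ n =>
      rw [← mul_assoc, map_sub, PowerSeries.coeff_succ_mul_X, PowerSeries.coeff_C_mul]
      simp [gaussCoeff]

/-! ### The congruence for integer exponents -/

theorem coeff_prod_one_sub_C_mul_X {R ι : Type*} [CommRing R] (s : Finset ι) (a : ι → R) {n : ℕ}
    (h : s.card < n) :
    PowerSeries.coeff n (∏ i ∈ s, (1 - PowerSeries.C (a i) * PowerSeries.X)) = 0 := by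
  classical
  induction s using Finset.induction_on generalizing n with
  | empty => simp at h; simp [PowerSeries.coeff_one, h.ne']
  | insert i s hi ih =>
    rw [Finset.card_insert_of_notMem hi] at h
    obtain ⟨n, rfl⟩ := Nat.exists_eq_succ_of_ne_zero (Nat.ne_zero_of_lt h)
    rw [Finset.prod_insert hi, sub_mul, one_mul, map_sub, ih (by omega), mul_assoc,
      PowerSeries.coeff_C_mul, PowerSeries.coeff_succ_X_mul, ih (by omega), mul_zero, sub_zero]

/-- As deg A < p, only one pair of exponents contributes: Euclidean division of the index by p is
unique. -/
theorem coeff_mul_expand {R : Type*} [CommRing R] {p : ℕ} (hp : p ≠ 0) {A : PowerSeries R}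
    (hA : ∀ n, p ≤ n → PowerSeries.coeff n A = 0) (U : PowerSeries R) (m : ℕ) {r : ℕ}
    (hr : r < p) :
    PowerSeries.coeff (p * m + r) (A * PowerSeries.expand p hp U) =
      PowerSeries.coeff r A * PowerSeries.coeff m U := by
  rw [PowerSeries.coeff_mul, Finset.sum_eq_single (r, p * m), PowerSeries.coeff_expand_mul]
  · rintro ⟨i, j⟩ hij hne
    rw [Finset.HasAntidiagonal.mem_antidiagonal] at hij
    dsimp only at hij ⊢
    by_cases hj : p ∣ j
    · obtain ⟨t, rfl⟩ := hj
      rcases le_or_gt p i with hi | hi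
      · rw [hA i hi, zero_mul]
      · exfalso
        apply hne
        have h1 : i = r := by
          have := congrArg (· % p) hij
          simpa [Nat.mod_eq_of_lt hi, Nat.mod_eq_of_lt hr] using this
        subst h1
        rw [Prod.mk.injEq]
        exact ⟨rfl, by omega⟩
    · rw [PowerSeries.coeff_expand_of_not_dvd p hp U hj, mul_zero]
  · intro h
    simp [add_comm] at h

theorem prod_one_sub_pow_mul {R : Type*} [CommRing R] [IsDomain R] {p : ℕ} (hp : 0 < p) {ζ : R}
    (h : IsPrimitiveRoot ζ p) (x : R) : ∏ i ∈ Finset.range p, (1 - ζ ^ i * x) = 1 - x ^ p := by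
  classical
  have h1 : nthRootsFinset p (1 : R) = (Finset.range p).image (ζ ^ ·) := by
    refine (Finset.eq_of_subset_of_card_le ?_ ?_).symm
    · intro y hy
      obtain ⟨i, -, rfl⟩ := Finset.mem_image.1 hy
      rw [mem_nthRootsFinset hp, ← pow_mul, mul_comm, pow_mul, h.pow_eq_one, one_pow]
    · rw [h.card_nthRootsFinset, Finset.card_image_of_injOn, Finset.card_range]
      intro i hi j hj hij
      exact h.pow_inj (by simpa using hi) (by simpa using hj) hij
  have h2 := h.pow_sub_pow_eq_prod_sub_mul 1 x hp
  rw [one_pow] at h2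
  rw [h2, h1, Finset.prod_image]
  intro i hi j hj hij
  exact h.pow_inj (by simpa using hi) (by simpa using hj) hij

theorem prod_range_mul_of_isPrimitiveRoot {K : Type*} [Field K] {p : ℕ} (hp : 0 < p) {ζ : K}
    (h : IsPrimitiveRoot ζ p) (M : ℕ) :
    ∏ i ∈ Finset.range (p * M), (1 - PowerSeries.C (ζ ^ i) * PowerSeries.X) =
      (1 - PowerSeries.X ^ p) ^ M := by
  induction M with
  | zero => simp
  | succ M ih =>
    rw [mul_add_one, Finset.prod_range_add, ih, pow_succ]
    congr 1
    rw [← prod_one_sub_pow_mul hp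
      (h.map_of_injective (f := PowerSeries.C) PowerSeries.C_injective) PowerSeries.X]
    refine Finset.prod_congr rfl fun i _ => ?_
    rw [pow_add, pow_mul, h.pow_eq_one, one_pow, one_mul, map_pow]

/-- A `q`-analogue of Lucas' theorem. -/
theorem cyclotomic_dvd_gaussCoeff_sub {p : ℕ} (hp : 0 < p) {N M s : ℕ} (hN : N + s = p * M)
    (hs : s < p) (m : ℕ) {r : ℕ} (hr : r < p) :
    cyclotomic p ℤ ∣
      gaussCoeff N (p * m + r) - gaussCoeff N r * expand ℤ p (gaussCoeff M m) := by
  have hζ := Complex.isPrimitiveRoot_exp p hp.ne'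
  generalize Complex.exp (2 * Real.pi * Complex.I / p) = ζ at hζ
  -- Divisibility by the minimal polynomial of ζ amounts to vanishing at ζ; there q^p becomes 1, so
  -- U is taken at q = 1.
  rw [cyclotomic_eq_minpoly hζ hp]
  refine minpoly.isIntegrallyClosed_dvd (hζ.isIntegral hp) ?_
  set S : PowerSeries ℂ := PowerSeries.mk fun n => aeval ζ (gaussCoeff N n) with hS
  set U : PowerSeries ℂ := PowerSeries.mk fun n => aeval (1 : ℂ) (gaussCoeff M n) with hU
  set T : PowerSeries ℂ :=
    ∏ i ∈ Finset.range s, (1 - PowerSeries.C (ζ ^ (N + i)) * PowerSeries.X) with hT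
  have hS1 := mk_gaussCoeff_mul_prod (aeval ζ : ℤ[X] →ₐ[ℤ] ℂ).toRingHom N
  have hU1 := mk_gaussCoeff_mul_prod (aeval (1 : ℂ) : ℤ[X] →ₐ[ℤ] ℂ).toRingHom M
  simp only [AlgHom.toRingHom_eq_coe, RingHom.coe_coe, aeval_X, one_pow, map_one, one_mul,
    Finset.prod_const, Finset.card_range] at hS1 hU1
  rw [← hS] at hS1
  rw [← hU] at hU1
  have hU2 := congrArg (PowerSeries.expand p hp.ne') hU1
  rw [map_mul, map_pow, map_sub, map_one, PowerSeries.expand_X] at hU2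
  have hprod := prod_range_mul_of_isPrimitiveRoot hp hζ M
  rw [← hN, Finset.prod_range_add] at hprod
  have hST : S = T * PowerSeries.expand p hp.ne' U := by
    rw [← hprod] at hU2
    linear_combination (-S) * hU2 + PowerSeries.expand p hp.ne' U * T * hS1
  have hTc : ∀ n, p ≤ n → PowerSeries.coeff n T = 0 := fun n hn =>
    coeff_prod_one_sub_C_mul_X _ _ (by rw [Finset.card_range]; omega)
  have key := fun m => coeff_mul_expand hp.ne' hTc U m hr
  simp only [← hST] at key
  -- The case m = 0 identifies the coefficient of z^r in T with `gaussCoeff N r` at ζ.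
  have k0 := key 0
  have km := key m
  simp only [hS, hU, PowerSeries.coeff_mk, gaussCoeff_zero_right, map_one, mul_one, mul_zero,
    zero_add] at k0 km
  rw [map_sub, map_mul, km, k0, expand_aeval, hζ.pow_eq_one, sub_self]

/-! ### Powers of q and Frobenius modulo 𝔪^k -/

variable (p : ℕ) [hp : Fact p.Prime]

@[simp]
theorem evalₐ_ofPoly (k : ℕ) (P : ℤ[X]) :
    AdicCompletion.evalₐ (mLoc p) k (ofPoly p P) =
      Ideal.Quotient.mk (mLoc p ^ k) (algebraMap ℤ[X] (ZqLoc p) P) :=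
  AlgHom.commutes _ _

@[simp]
theorem evalₐ_q (k : ℕ) :
    AdicCompletion.evalₐ (mLoc p) k (q p) = Ideal.Quotient.mk (mLoc p ^ k) (qLoc p) :=
  evalₐ_ofPoly p k X

theorem mk_qLoc_pow_eq {k M N : ℕ} (h : M ≡ N [MOD p ^ k]) :
    Ideal.Quotient.mk (mLoc p ^ k) (qLoc p ^ M) = Ideal.Quotient.mk (mLoc p ^ k) (qLoc p ^ N) := by
  have h1 : Ideal.Quotient.mk (mLoc p ^ k) (qLoc p ^ p ^ k) = 1 := by
    rw [← map_one (Ideal.Quotient.mk (mLoc p ^ k)), Ideal.Quotient.eq]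
    exact qLoc_pow_sub_one_mem p k
  have h2 : ∀ M, Ideal.Quotient.mk (mLoc p ^ k) (qLoc p ^ M) =
      Ideal.Quotient.mk (mLoc p ^ k) (qLoc p ^ (M % p ^ k)) := fun M => by
    conv_lhs => rw [← Nat.div_add_mod M (p ^ k), pow_add, pow_mul, map_mul, map_pow, h1, one_pow,
      one_mul]
  rw [h2 M, h2 N, h]

theorem evalₐ_qPow {k N : ℕ} {β : ℤ_[p]} (h : PadicInt.toZModPow k β = N) :
    AdicCompletion.evalₐ (mLoc p) k (qPow p β) = Ideal.Quotient.mk (mLoc p ^ k) (qLoc p ^ N) := by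
  rw [qPow, AdicCompletion.evalₐ_mk]
  exact mk_qLoc_pow_eq p ((ZMod.natCast_eq_natCast_iff _ _ _).1 h)

theorem toZModPow_eq_appr (k : ℕ) (β : ℤ_[p]) :
    PadicInt.toZModPow k β = (β.appr k : ZMod (p ^ k)) := rfl

@[simp]
theorem frobLoc_algebraMap (P : ℤ[X]) :
    frobLoc p (algebraMap ℤ[X] (ZqLoc p) P) = algebraMap ℤ[X] (ZqLoc p) (expand ℤ p P) :=
  Localization.localRingHom_to_map _ _ _ _ _

theorem evalₐ_frob (k : ℕ) (x : Zqp p) :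
    AdicCompletion.evalₐ (mLoc p) k (frob p x) = frobMod p k x :=
  AdicCompletion.evalₐ_liftRingHom _ _ _ _ _

theorem frob_ofPoly (P : ℤ[X]) : frob p (ofPoly p P) = ofPoly p (expand ℤ p P) := by
  refine AdicCompletion.ext_evalₐ fun k => ?_
  rw [evalₐ_frob, frobMod, RingHom.comp_apply, RingHom.coe_coe, evalₐ_ofPoly, evalₐ_ofPoly,
    Ideal.quotientMap_mk, frobLoc_algebraMap]

theorem frob_q : frob p (q p) = q p ^ p := by
  rw [q, frob_ofPoly, expand_X, map_pow]

theorem frob_qPow {β : ℤ_[p]} {s : ℕ} (h : p * β = β + s) :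
    frob p (qPow p β) = qPow p β * q p ^ s := by
  refine AdicCompletion.ext_evalₐ fun k => ?_
  have hq : frobLoc p (qLoc p) = qLoc p ^ p := by
    rw [qLoc, frobLoc_algebraMap, expand_X, map_pow]
  rw [evalₐ_frob, frobMod, RingHom.comp_apply, RingHom.coe_coe, map_mul, map_pow, evalₐ_q,
    evalₐ_qPow p (toZModPow_eq_appr p k β), Ideal.quotientMap_mk, map_pow, hq, ← pow_mul,
    ← map_pow, ← map_mul, ← pow_add]
  refine mk_qLoc_pow_eq p ((ZMod.natCast_eq_natCast_iff _ _ _).1 ?_)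
  have := congrArg (PadicInt.toZModPow k) h
  rw [map_mul, map_add, map_natCast, map_natCast, toZModPow_eq_appr] at this
  exact_mod_cast this

theorem coe_ratToPadicInt (α : ℚ) (h : ¬ p ∣ α.den) : (ratToPadicInt p α h : ℚ_[p]) = α := rfl

/-- With α = a/b and p - 1 = bc, take s = (p-1)α = ac, which is at most p - 1 because α ≤ 1. -/
theorem exists_mul_ratToPadicInt_eq {α : ℚ} (hα0 : 0 < α) (hα1 : α ≤ 1)
    (hpα : p ≡ 1 [MOD α.den]) :
    ∃ s : ℕ, s < p ∧ p * ratToPadicInt p α (not_dvd_of_modEq_one p hpα) =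
      ratToPadicInt p α (not_dvd_of_modEq_one p hpα) + s := by
  have hp1 := hp.out.one_lt
  obtain ⟨c, hc⟩ := (Nat.modEq_iff_dvd' hp1.le).1 hpα.symm
  have hpc : (p : ℚ) = 1 + α.den * c := by
    rw [← Nat.cast_mul, ← hc, Nat.cast_sub hp1.le]
    simp
  have hnum : ((α.num.toNat : ℕ) : ℚ) = α * α.den := by
    rw [Rat.mul_den_eq_num]
    exact_mod_cast Int.toNat_of_nonneg (Rat.num_nonneg.2 hα0.le)
  have hs : (p : ℚ) * α = α + ((α.num.toNat * c : ℕ) : ℚ) := by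
    rw [Nat.cast_mul, hnum, hpc]
    ring
  refine ⟨α.num.toNat * c, ?_, ?_⟩
  · have h1 : ((α.num.toNat * c : ℕ) : ℚ) < p := by
      have h2 : ((p : ℚ) - 1) * α ≤ p - 1 :=
        mul_le_of_le_one_right (by rw [sub_nonneg]; exact_mod_cast hp1.le) hα1
      linarith
    exact_mod_cast h1
  · apply Subtype.ext
    have := congrArg (Rat.cast : ℚ → ℚ_[p]) hs
    rw [PadicInt.coe_mul, PadicInt.coe_add, coe_ratToPadicInt]
    rw [PadicInt.coe_natCast, PadicInt.coe_natCast, Nat.cast_mul]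
    push_cast at this
    exact this

theorem ofPoly_dvd_of_forall_evalₐ {P : ℤ[X]} (hP : P ≠ 0) {x : Zqp p}
    (h : ∀ k, ∃ Q, P ∣ Q ∧
      AdicCompletion.evalₐ (mLoc p) k x = AdicCompletion.evalₐ (mLoc p) k (ofPoly p Q)) :
    ofPoly p P ∣ x := by
  have : IsNoetherianRing (ZqLoc p) :=
    IsLocalization.isNoetherianRing (mIdeal p).primeCompl _ inferInstance
  have : IsDomain (ZqLoc p) :=
    IsLocalization.isDomain_localization (mIdeal p).primeCompl_le_nonZeroDivisors
  refine algebraMap_dvd_of_forall_evalₐ (mLoc p) ?_ fun k => ?_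
  · rw [Ne, IsLocalization.to_map_eq_zero_iff (ZqLoc p)
      (mIdeal p).primeCompl_le_nonZeroDivisors]
    exact hP
  · obtain ⟨Q, hQ, hx⟩ := h k
    exact ⟨_, map_dvd (algebraMap ℤ[X] (ZqLoc p)) hQ, hx.trans (evalₐ_ofPoly p k Q)⟩

/-! ### Passage to p-adic exponents -/

theorem qPoch_eq_poch (x : Zqp p) (n : ℕ) : qPoch p x n = poch (q p) x n := rfl

theorem ofPoly_poch (n : ℕ) : ofPoly p (poch X X n) = qPoch p (q p) n :=
  map_poch _ _ _ _

theorem poch_X_ne_zero (n : ℕ) : poch (X : ℤ[X]) X n ≠ 0 := fun h => by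
  have := congrArg (Polynomial.eval 0) h
  simp [poch, Polynomial.eval_prod] at this

theorem evalₐ_qPow_eq_ofPoly {k N : ℕ} {β : ℤ_[p]} (h : PadicInt.toZModPow k β = N) :
    AdicCompletion.evalₐ (mLoc p) k (qPow p β) =
      AdicCompletion.evalₐ (mLoc p) k (ofPoly p (X ^ N)) := by
  rw [evalₐ_qPow p h, evalₐ_ofPoly, map_pow (algebraMap _ _)]
  rfl

theorem qPoch_q_dvd_qPoch_qPow (β : ℤ_[p]) (n : ℕ) : qPoch p (q p) n ∣ qPoch p (qPow p β) n := by
  rw [← ofPoly_poch]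
  refine ofPoly_dvd_of_forall_evalₐ p (poch_X_ne_zero n) fun k =>
    ⟨poch X (X ^ β.appr k) n, ⟨_, (poch_mul_gaussCoeff _ n).symm⟩, ?_⟩
  rw [map_poch (ofPoly p), qPoch_eq_poch, ← RingHom.coe_coe, map_poch, map_poch, RingHom.coe_coe,
    evalₐ_qPow_eq_ofPoly p (toZModPow_eq_appr p k β)]
  rfl

/-- The coefficient of `zⁿ` in `f_β`, as an element of `ℤ_{q,p}`. -/
noncomputable def hypCoeffInt (β : ℤ_[p]) (n : ℕ) : Zqp p := (qPoch_q_dvd_qPoch_qPow p β n).choose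

theorem qPoch_mul_hypCoeffInt (β : ℤ_[p]) (n : ℕ) :
    qPoch p (q p) n * hypCoeffInt p β n = qPoch p (qPow p β) n :=
  (qPoch_q_dvd_qPoch_qPow p β n).choose_spec.symm

theorem algebraMap_hypCoeffInt (β : ℤ_[p]) (n : ℕ) :
    algebraMap (Zqp p) (FractionRing (Zqp p)) (hypCoeffInt p β n) = hypCoeff p β n := by
  rw [hypCoeff, IsLocalization.eq_mk'_iff_mul_eq, ← map_mul, mul_comm, qPoch_mul_hypCoeffInt]

theorem exists_approx {β : ℤ_[p]} {s : ℕ} (hs : s < p) (h : p * β = β + s) (k : ℕ) :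
    ∃ N M : ℕ, N + s = p * M ∧ PadicInt.toZModPow k β = N := by
  have hle : s ≤ p * (β.appr k + p ^ k) :=
    hs.le.trans (Nat.le_mul_of_pos_right p (by have := hp.out.pos; positivity))
  -- Modulo p^k, pβ - s = β. The extra p^k keeps the truncated subtraction exact.
  refine ⟨p * (β.appr k + p ^ k) - s, β.appr k + p ^ k, Nat.sub_add_cancel hle, ?_⟩
  have h1 := congrArg (PadicInt.toZModPow k) h
  rw [map_mul, map_add, map_natCast, map_natCast, toZModPow_eq_appr] at h1
  rw [toZModPow_eq_appr, Nat.cast_sub hle, Nat.cast_mul, Nat.cast_add, Nat.cast_pow,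
    ← Nat.cast_pow, ZMod.natCast_self, add_zero, h1, add_sub_cancel_right]

theorem frob_qPoch (x : Zqp p) (n : ℕ) :
    frob p (qPoch p x n) = poch (q p ^ p) (frob p x) n := by
  rw [qPoch_eq_poch, map_poch, frob_q]

theorem frob_qPoch_q (n : ℕ) :
    frob p (qPoch p (q p) n) = ofPoly p (expand ℤ p (poch X X n)) := by
  rw [← ofPoly_poch, frob_ofPoly]

/-- Only the numerators are explicit in q^β, so denominators are cleared by D. Since D need not be
invertible modulo 𝔪^k, divisibility by D φ_p is proved in the limit and D is cancelled afterwards.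
-/
theorem phi_dvd_hypCoeffInt_sub {β : ℤ_[p]} {s : ℕ} (hs : s < p) (h : p * β = β + s) (m : ℕ)
    {r : ℕ} (hr : r < p) :
    phi p ∣ hypCoeffInt p β (p * m + r) - hypCoeffInt p β r * frob p (hypCoeffInt p β m) := by
  set n := p * m + r with hn
  set D : ℤ[X] := poch X X n * poch X X r * expand ℤ p (poch X X m) with hD
  have hD0 : D ≠ 0 := mul_ne_zero (mul_ne_zero (poch_X_ne_zero _) (poch_X_ne_zero _))
    ((expand_ne_zero hp.out.pos).2 (poch_X_ne_zero m))
  have hF := congrArg (frob p) (qPoch_mul_hypCoeffInt p β m)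
  rw [map_mul, frob_qPoch_q, frob_qPoch, frob_qPow p h] at hF
  have key : ofPoly p D *
      (hypCoeffInt p β n - hypCoeffInt p β r * frob p (hypCoeffInt p β m)) =
      ofPoly p (poch X X r * expand ℤ p (poch X X m)) * poch (q p) (qPow p β) n -
        ofPoly p (poch X X n) * poch (q p) (qPow p β) r *
          poch (q p ^ p) (qPow p β * q p ^ s) m := by
    rw [← hF, ← qPoch_eq_poch, ← qPoch_eq_poch, ← qPoch_mul_hypCoeffInt, ← qPoch_mul_hypCoeffInt,
      ← ofPoly_poch, ← ofPoly_poch, hD]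
    simp only [map_mul]
    ring
  have hdvd : ofPoly p (D * cyclotomic p ℤ) ∣ ofPoly p D *
      (hypCoeffInt p β n - hypCoeffInt p β r * frob p (hypCoeffInt p β m)) := by
    rw [key]
    refine ofPoly_dvd_of_forall_evalₐ p (mul_ne_zero hD0 (cyclotomic_ne_zero p ℤ)) fun k => ?_
    obtain ⟨N, M, hNM, hN⟩ := exists_approx p hs h k
    -- This is the right side of `key` with q^β replaced by q^N; it equals D times the difference of
    -- Gaussian binomials.
    refine ⟨poch X X r * expand ℤ p (poch X X m) * poch X (X ^ N) n -
      poch X X n * poch X (X ^ N) r * poch (X ^ p) (X ^ N * X ^ s) m, ?_, ?_⟩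
    · have hM : poch ((X : ℤ[X]) ^ p) (X ^ N * X ^ s) m =
          expand ℤ p (poch X X m) * expand ℤ p (gaussCoeff M m) := by
        rw [← map_mul, poch_mul_gaussCoeff, ← RingHom.coe_coe (expand ℤ p), map_poch, map_pow,
          RingHom.coe_coe, expand_X, ← pow_add, hNM, pow_mul]
      rw [hM, ← poch_mul_gaussCoeff, ← poch_mul_gaussCoeff]
      obtain ⟨c, hc⟩ := cyclotomic_dvd_gaussCoeff_sub hp.out.pos hNM hs m hr
      exact ⟨c, by linear_combination D * hc⟩
    · have hq : ofPoly p X = q p := rfl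
      have hx := evalₐ_qPow_eq_ofPoly p hN
      generalize AdicCompletion.evalₐ (mLoc p) k = ev at hx ⊢
      rw [← RingHom.coe_coe] at hx ⊢
      simp only [map_sub, map_mul, map_poch] at hx ⊢
      simp only [hx, map_pow, hq]
  rw [map_mul] at hdvd
  obtain ⟨c, hc⟩ := hdvd
  refine ⟨c, ?_⟩
  rw [mul_assoc] at hc
  exact (mul_cancel_left_mem_nonZeroDivisors (ofPoly_mem_nonZeroDivisors p hD0)).1 hc

end QFrobenius

/-! ### Assembly of the coefficientwise congruences -/

theorem mainTheorem4 (p : ℕ) [hp : Fact p.Prime] (α : ℚ) (hα0 : 0 < α) (hα1 : α ≤ 1)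
    (hpα : p ≡ 1 [MOD α.den]) :
    ∃ f : PowerSeries (QFrobenius.Zqp p),
      PowerSeries.map
          (algebraMap (QFrobenius.Zqp p) (FractionRing (QFrobenius.Zqp p))) f =
        QFrobenius.hypSeries p
          (QFrobenius.ratToPadicInt p α (QFrobenius.not_dvd_of_modEq_one p hpα)) ∧
      f ≡ (∑ n ∈ Finset.range p, PowerSeries.C (PowerSeries.coeff n f) * PowerSeries.X ^ n) *
          QFrobenius.frobSeries p f
        [SMOD (Ideal.span {PowerSeries.C (QFrobenius.phi p)} :
          Ideal (PowerSeries (QFrobenius.Zqp p)))] := by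
  obtain ⟨s, hs, h⟩ := QFrobenius.exists_mul_ratToPadicInt_eq p hα0 hα1 hpα
  generalize QFrobenius.ratToPadicInt p α (QFrobenius.not_dvd_of_modEq_one p hpα) = β at h ⊢
  refine ⟨PowerSeries.mk (QFrobenius.hypCoeffInt p β), ?_, ?_⟩
  · ext n
    simp [QFrobenius.hypSeries, QFrobenius.algebraMap_hypCoeffInt]
  · set f := PowerSeries.mk (QFrobenius.hypCoeffInt p β) with hf
    set A := ∑ n ∈ Finset.range p, PowerSeries.C (PowerSeries.coeff n f) * PowerSeries.X ^ n
      with hA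
    have hAc : ∀ n, PowerSeries.coeff n A = if n < p then PowerSeries.coeff n f else 0 := by
      intro n
      simp [hA, PowerSeries.coeff_C_mul, PowerSeries.coeff_X_pow]
    rw [SModEq.sub_mem, Ideal.mem_span_singleton]
    have hdvd : ∀ n, QFrobenius.phi p ∣
        PowerSeries.coeff n (f - A * QFrobenius.frobSeries p f) := by
      intro n
      have hr := Nat.mod_lt n hp.out.pos
      rw [← Nat.div_add_mod n p]
      have h1 := QFrobenius.coeff_mul_expand hp.out.ne_zero (A := A)
        (fun n hn => by rw [hAc, if_neg hn.not_gt])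
        (PowerSeries.map (QFrobenius.frob p) f) (n / p) hr
      rw [map_sub]
      change _ ∣ _ - PowerSeries.coeff (p * (n / p) + n % p) (A * PowerSeries.expand p
        hp.out.ne_zero (PowerSeries.map (QFrobenius.frob p) f))
      rw [h1, hAc, if_pos hr, hf, PowerSeries.coeff_map, PowerSeries.coeff_mk,
        PowerSeries.coeff_mk, PowerSeries.coeff_mk]
      exact QFrobenius.phi_dvd_hypCoeffInt_sub p hs h _ hr
    choose c hc using hdvd
    refine ⟨PowerSeries.mk c, ?_⟩
    ext n
    rw [hc, PowerSeries.coeff_C_mul, PowerSeries.coeff_mk]
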